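/- Let $k \ge 1$ be a constant. In the $\mu$-Congested Clique model, $n$ nodes communicate in synchronous rounds; in each round every node may send one word of $O(\log n)$ bits to every other node, and every node has a memory of $\mu$ words of $O(\log n)$ bits, which has to hold its input and everything it keeps between rounds. The input is an arbitrary graph $G$ on the $n$ nodes, and each node initially knows its own neighbours in $G$. Local computation is free, and emitted outputs do not occupy memory. If $n \le \mu \le n^{2-2/k}$, then there is a deterministic algorithm in this model that lists all $k$-node subgraphs of $G$ within $O\bigl(n^{k-2}/\mu^{k/2-1}\bigr)$ rounds, that is, the union of the outputs of all nodes is exactly the set of all $k$-node subgraphs of $G$. Likewise, within the same number of rounds, there is a deterministic algorithm that lists exactly the induced $k$-node subgraphs of $G$. The constants hidden in the $O$-notation depend only on $k$. -/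

import Mathlib

namespace MuCongestedClique

/-- A word of `O(log n)` bits: a bit string of length `c * (⌊log₂ n⌋ + 1)`. -/
abbrev Word (c n : ℕ) : Type := Fin (c * (Nat.log 2 n + 1)) → Bool

/-- The local memory of a node: `μ` words. -/
abbrev Memory (c n μ : ℕ) : Type := Fin μ → Word c n

/-- A deterministic algorithm with outputs in `Out` for the Congested Clique on the nodes `Fin n`
in which every node has a memory of `μ` words. Whatever a node keeps from one round to the next
(its input, a round counter, intermediate results) has to be kept in its memory; local computation
is free, and emitted outputs do not occupy memory. -/
structure Algorithm (c n μ : ℕ) (Out : Type) where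
  /-- The initial memory of a node, computed from its input, the set of its neighbours. -/
  init : Fin n → Set (Fin n) → Memory c n μ
  /-- In every round, a node sends one word to every other node (all-to-all communication). -/
  send : (v : Fin n) → Memory c n μ → {u : Fin n // u ≠ v} → Word c n
  /-- The new memory of a node, from its memory and the words it received from the other nodes. -/
  receive : (v : Fin n) → Memory c n μ → ({u : Fin n // u ≠ v} → Word c n) → Memory c n μ
  /-- The outputs that a node emits, read off from its current memory. -/
  emit : Fin n → Memory c n μ → Set Out

namespace Algorithm

variable {c n μ : ℕ} {Out : Type}

/-- The memories of all nodes after `t` synchronous rounds on the input graph `G`. -/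
def memoryAfter (A : Algorithm c n μ Out) (G : SimpleGraph (Fin n)) :
    ℕ → Fin n → Memory c n μ
  | 0, v => A.init v (G.neighborSet v)
  | t + 1, v => A.receive v (A.memoryAfter G t v)
      (fun u => A.send u.1 (A.memoryAfter G t u.1) ⟨v, u.2.symm⟩)

/-- The union of the outputs that all nodes emit in an execution of `T` rounds on `G`. -/
def listed (A : Algorithm c n μ Out) (G : SimpleGraph (Fin n)) (T : ℕ) : Set Out :=
  {x | ∃ t ≤ T, ∃ v : Fin n, x ∈ A.emit v (A.memoryAfter G t v)}

end Algorithm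

/-- Graphs whose vertices are some of the `n` nodes, that is, a vertex set together with a set of
edges between these vertices. -/
abbrev Piece (n : ℕ) : Type := (⊤ : SimpleGraph (Fin n)).Subgraph

/-- The `k`-node subgraphs of `G`. -/
def kSubgraphs {n : ℕ} (k : ℕ) (G : SimpleGraph (Fin n)) : Set (Piece n) :=
  {H | H.verts.ncard = k ∧ ∀ a b, H.Adj a b → G.Adj a b}

/-- The induced `k`-node subgraphs of `G`. -/
def kInducedSubgraphs {n : ℕ} (k : ℕ) (G : SimpleGraph (Fin n)) : Set (Piece n) :=
  {H | H.verts.ncard = k ∧ ∀ a b, H.Adj a b ↔ a ∈ H.verts ∧ b ∈ H.verts ∧ G.Adj a b}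

/-- Some deterministic algorithm with `μ` words of memory per node lists, in `T` rounds, exactly
the set `target G` on every `n`-node input graph `G`. -/
def ListableIn (c n μ T : ℕ) (target : SimpleGraph (Fin n) → Set (Piece n)) : Prop :=
  ∃ A : Algorithm c n μ (Piece n), ∀ G : SimpleGraph (Fin n), A.listed G T = target G

end MuCongestedClique

/-!
Let `s = ⌊√μ⌋` and cut the nodes into `p = n / s + 1` parts, the part of `x` being `x / s`. Every
set of `k` nodes lies in the union of at most `k` parts, so it suffices that, for each of the
`p ^ k` tuples of `k` parts, some node learns all edges among the parts of that tuple. These are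
`k ^ 2` blocks of at most `s ^ 2 ≤ μ` bits, which fit into the memory of one node.

The blocks are delivered without any routing congestion, because the adjacency matrix is spread
beforehand: the entry `(x, y)` is given to the node `(s * x + y) % n`.
* For fixed `x` this is a bijection in `y`, so one round, with one bit per message, spreads the
  matrix, and afterwards every node keeps one entry of each row.
* Within one block, `s * x + y` is a constant plus `z = s * (x % s) + y % s`, and `z < s ^ 2`
  determines the entry (`eq_of_block_position_eq`). So every node keeps at most `⌈μ / n⌉` entries
  of each block, told apart by the quotient `z / n`.

Hence in `k ^ 2 * (μ / n + 1)` rounds, in each of which every node sends one bit to every other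
node, each of the `n` nodes learns the blocks of a tuple of its own
(`blockProtocol_buffer`). Doing so for all `p ^ k` tuples takes `p ^ k / n + 1` batches of that
length. Since `p = O(n / √μ)` and `(n / √μ) ^ k ≥ n`, the total is `O((n / √μ) ^ (k - 2))` rounds
(`rounds_le`). At the end of a batch a node emits the targets that its tuple of parts contains;
only the adjacencies between the vertices of a target matter for this, so subgraphs and induced
subgraphs are treated alike (`mem_listed_blockProtocol_iff`).
-/

namespace MuCongestedClique

/-! ### Protocols with one-bit messages and arbitrary states -/

/-- A deterministic protocol for the clique on `Fin n` whose nodes have states in `S` and send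
one bit per round along every link. For uniformity a node also sends a bit to itself; this is local
computation in an actual `Algorithm`. -/
structure BitProtocol (n : ℕ) (S Out : Type) where
  /-- The initial state of a node, from its set of neighbours. -/
  init : Fin n → Set (Fin n) → S
  /-- `msg u σ w` is the bit that `u` sends to `w` when in state `σ`. -/
  msg : Fin n → S → Fin n → Bool
  /-- The new state of a node, from its state and the bits it received. -/
  next : Fin n → S → (Fin n → Bool) → S
  /-- The outputs that a node emits in a given state. -/
  emit : Fin n → S → Set Out

namespace BitProtocol

variable {n : ℕ} {S Out : Type}

/-- The states of all nodes after `t` rounds on the input graph `G`. -/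
def stateAfter (P : BitProtocol n S Out) (G : SimpleGraph (Fin n)) : ℕ → Fin n → S
  | 0, v => P.init v (G.neighborSet v)
  | t + 1, v => P.next v (P.stateAfter G t v) (fun u => P.msg u (P.stateAfter G t u) v)

/-- The union of all outputs in an execution of `T` rounds on `G`. -/
def listed (P : BitProtocol n S Out) (G : SimpleGraph (Fin n)) (T : ℕ) : Set Out :=
  {x | ∃ t ≤ T, ∃ v : Fin n, x ∈ P.emit v (P.stateAfter G t v)}

/-- A protocol whose states can be encoded in the memory of a node is an algorithm of the
Congested Clique. A bit is sent as a constant word. -/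
theorem exists_algorithm_listed_eq [Nonempty S] {c μ : ℕ} (hc : 0 < c)
    (enc : S ↪ Memory c n μ) (P : BitProtocol n S Out) :
    ∃ A : Algorithm c n μ Out, ∀ G T, A.listed G T = P.listed G T := by
  classical
  have hdec : ∀ σ, Function.invFun enc (enc σ) = σ := Function.leftInverse_invFun enc.injective
  let b₀ : Fin (c * (Nat.log 2 n + 1)) := ⟨0, by positivity⟩
  let A : Algorithm c n μ Out :=
    { init := fun v N => enc (P.init v N)
      send := fun v M u _ => P.msg v (Function.invFun enc M) u
      receive := fun v M m => enc (P.next v (Function.invFun enc M) fun u =>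
        if h : u ≠ v then m ⟨u, h⟩ b₀ else P.msg v (Function.invFun enc M) v)
      emit := fun v M => P.emit v (Function.invFun enc M) }
  have hrun : ∀ G t v, A.memoryAfter G t v = enc (P.stateAfter G t v) := by
    intro G t
    induction t with
    | zero => intro v; rfl
    | succ t ih =>
      intro v
      simp only [Algorithm.memoryAfter, stateAfter, ih]
      simp only [A, hdec]
      congr 2
      funext u
      by_cases h : u = v
      · subst h; simp
      · simp [h]
  refine ⟨A, fun G T => ?_⟩
  simp only [Algorithm.listed, listed, hrun]
  simp only [A, hdec]

end BitProtocol

/-! ### Spreading the adjacency matrix -/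

/-- Two entries of the adjacency matrix that lie in the same block and are held by the same node
agree if their positions in the block have the same quotient by `n`. -/
theorem eq_of_block_position_eq {n s x y x' y' : ℕ} (hs : 0 < s)
    (hx : x / s = x' / s) (hy : y / s = y' / s)
    (hu : (s * x + y) % n = (s * x' + y') % n)
    (hr : (s * (x % s) + y % s) / n = (s * (x' % s) + y' % s) / n) :
    x = x' ∧ y = y' := by
  have split : ∀ a b : ℕ, s * a + b = s * (s * (a / s)) + s * (b / s) + (s * (a % s) + b % s) := by
    intro a b
    have ha := Nat.div_add_mod a s
    have hb := Nat.div_add_mod b s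
    calc s * a + b = s * (s * (a / s) + a % s) + (s * (b / s) + b % s) := by rw [ha, hb]
      _ = _ := by ring
  rw [split x y, split x' y', hx, hy] at hu
  have hz : (s * (x % s) + y % s) % n = (s * (x' % s) + y' % s) % n :=
    Nat.ModEq.add_left_cancel' _ hu
  have hzz : s * (x % s) + y % s = s * (x' % s) + y' % s := by
    rw [← Nat.div_add_mod (s * (x % s) + y % s) n, hz, hr, Nat.div_add_mod]
  have hym : y % s = y' % s := by
    have := congrArg (· % s) hzz
    simpa using this
  have hxm : x % s = x' % s := by
    rw [hym] at hzz
    exact Nat.eq_of_mul_eq_mul_left hs (Nat.add_right_cancel hzz)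
  exact ⟨by rw [← Nat.div_add_mod x s, hx, hxm, Nat.div_add_mod],
    by rw [← Nat.div_add_mod y s, hy, hym, Nat.div_add_mod]⟩

/-- The node that holds the entry `(x, y)` of the adjacency matrix after it has been spread. -/
def holder {n : ℕ} (s : ℕ) (x y : Fin n) : Fin n :=
  ⟨(s * x + y) % n, Nat.mod_lt _ x.pos⟩

theorem holder_right_injective {n : ℕ} (s : ℕ) (x : Fin n) :
    Function.Injective (holder s x) := by
  intro y y' h
  have h' : s * (x : ℕ) + y ≡ s * x + y' [MOD n] := congrArg Fin.val h
  exact Fin.ext ((Nat.ModEq.add_left_cancel' _ h').eq_of_lt_of_lt y.2 y'.2)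

/-- Whether the entry of row `x` that the node `u` holds is an edge of `G`. -/
def Share {n : ℕ} (s : ℕ) (G : SimpleGraph (Fin n)) (u x : Fin n) : Prop :=
  ∃ y, holder s x y = u ∧ G.Adj x y

theorem share_holder_iff {n : ℕ} (s : ℕ) (G : SimpleGraph (Fin n)) (x y : Fin n) :
    Share s G (holder s x y) x ↔ G.Adj x y := by
  constructor
  · rintro ⟨y', h, hadj⟩
    rwa [holder_right_injective s x h] at hadj
  · exact fun h => ⟨y, rfl, h⟩

/-- The bit of the block `(i, j)` that a node `u` with shares `B` contributes for the quotient `r`: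
the entry `(x, y)` of this block held by `u` at a position `z` with `z / n = r`. It is `False` if
there is no such entry. -/
def BlockBit {n : ℕ} (s : ℕ) (B : Fin n → Prop) (u : Fin n) (i j r : ℕ) : Prop :=
  ∃ x y : Fin n, (x : ℕ) / s = i ∧ (y : ℕ) / s = j ∧ holder s x y = u ∧
    (s * (x % s) + y % s) / n = r ∧ B x

theorem blockBit_share_iff {n s : ℕ} (hs : 0 < s) (G : SimpleGraph (Fin n)) (x y : Fin n) :
    BlockBit s (Share s G (holder s x y)) (holder s x y) (x / s) (y / s)
      ((s * (x % s) + y % s) / n) ↔ G.Adj x y := by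
  constructor
  · rintro ⟨x', y', hx, hy, hu, hr, hB⟩
    obtain ⟨h₁, h₂⟩ := eq_of_block_position_eq hs hx hy (congrArg Fin.val hu) hr
    obtain rfl := Fin.ext h₁
    obtain rfl := Fin.ext h₂
    exact (share_holder_iff s G _ _).1 hB
  · exact fun h => ⟨x, y, rfl, rfl, rfl, rfl, (share_holder_iff s G x y).2 h⟩

/-! ### The listing protocol -/

/-- The tuple of parts with number `m`, given by the base-`p` digits of `m`. -/
def partTuple (p k m : ℕ) (a : Fin k) : ℕ := m / p ^ (a : ℕ) % p

theorem exists_partTuple_eq {p k : ℕ} (f : Fin k → ℕ) (hf : ∀ a, f a < p) :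
    ∃ m < p ^ k, partTuple p k m = f := by
  let g : Fin k → Fin p := fun a => ⟨f a, hf a⟩
  refine ⟨finFunctionFinEquiv g, (finFunctionFinEquiv g).2, funext fun a => ?_⟩
  have h := congrArg Fin.val (congrFun (finFunctionFinEquiv.symm_apply_apply g) a)
  rwa [finFunctionFinEquiv_symm_apply_val] at h

/-- The bits that a node receives from one other node in a batch: one for each ordered pair of
parts of its tuple and each quotient `r < R`. -/
abbrev Slot (k R : ℕ) : Type := (Fin k × Fin k) × Fin R

/-- The round of a batch in which the bits of a given slot are sent. -/
def slotIndex (k R : ℕ) : Slot k R ≃ Fin (k * k * R) :=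
  (finProdFinEquiv.prodCongr (Equiv.refl _)).trans finProdFinEquiv

/-- The state of a node: a round counter; one bit per node, which is the adjacency row of the node
at first and its shares after the first round; and a buffer for the bits received in a batch. -/
abbrev BlockState (k n R T : ℕ) : Type :=
  Fin (T + 1) × (Fin n → Bool) × (Slot k R → Fin n → Bool)

/-- The tuple of parts that the node `w` handles in batch `b`. -/
abbrev batchTuple {n : ℕ} (k p b : ℕ) (w : Fin n) : Fin k → ℕ := partTuple p k (b * n + w)

open Classical in
/-- The protocol that spreads the adjacency matrix in the first round and then, in batches of
`k * k * R` rounds, sends to every node the blocks of its tuple of parts. At the end of a batch, a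
node emits those `H` with vertices in the parts of its tuple that belong to `target G` for a graph
`G` agreeing with its buffer on these vertices. The round counter is capped at `T`. -/
noncomputable def blockProtocol (k n s p R T : ℕ) (target : SimpleGraph (Fin n) → Set (Piece n)) :
    BitProtocol n (BlockState k n R T) (Piece n) where
  init _ N := (0, fun x => decide (x ∈ N), fun _ _ => false)
  msg u σ w :=
    if (σ.1 : ℕ) = 0 then decide (∃ y, holder s u y = w ∧ σ.2.1 y = true)
    else decide (∃ j : Slot k R, (slotIndex k R j : ℕ) = (σ.1 - 1) % (k * k * R) ∧
      BlockBit s (fun x => σ.2.1 x = true) u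
        (batchTuple k p ((σ.1 - 1) / (k * k * R)) w j.1.1)
        (batchTuple k p ((σ.1 - 1) / (k * k * R)) w j.1.2) j.2)
  next _ σ m :=
    (⟨min (σ.1 + 1) T, by omega⟩,
      if (σ.1 : ℕ) = 0 then m else σ.2.1,
      fun j => if (slotIndex k R j : ℕ) = (σ.1 - 1) % (k * k * R) then m else σ.2.2 j)
  emit w σ :=
    {H | ∃ b, (σ.1 : ℕ) = 1 + (b + 1) * (k * k * R) ∧
      (∀ x ∈ H.verts, ∃ a, (x : ℕ) / s = batchTuple k p b w a) ∧
      ∃ G, H ∈ target G ∧ ∀ x ∈ H.verts, ∀ y ∈ H.verts, ∀ j : Slot k R,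
        (x : ℕ) / s = batchTuple k p b w j.1.1 → (y : ℕ) / s = batchTuple k p b w j.1.2 →
        (s * (x % s) + y % s) / n = j.2 → (σ.2.2 j (holder s x y) = true ↔ G.Adj x y)}

section Correctness

variable {k n s p R T : ℕ} {target : SimpleGraph (Fin n) → Set (Piece n)}

theorem blockProtocol_counter (G : SimpleGraph (Fin n)) (t : ℕ) (ht : t ≤ T) (v : Fin n) :
    (((blockProtocol k n s p R T target).stateAfter G t v).1 : ℕ) = t := by
  induction t with
  | zero => rfl
  | succ t ih =>
    simp only [BitProtocol.stateAfter]
    change min ((((blockProtocol k n s p R T target).stateAfter G t v).1 : ℕ) + 1) T = t + 1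
    rw [ih (by omega)]
    omega

theorem blockProtocol_shares (G : SimpleGraph (Fin n)) (t : ℕ) (ht : t + 1 ≤ T) (v x : Fin n) :
    ((blockProtocol k n s p R T target).stateAfter G (t + 1) v).2.1 x = true ↔ Share s G v x := by
  induction t with
  | zero =>
    simp [BitProtocol.stateAfter, blockProtocol, Share]
  | succ t ih =>
    rw [← ih (by omega)]
    have hc := blockProtocol_counter (k := k) (s := s) (p := p) (R := R) (T := T)
      (target := target) G (t + 1) (by omega) v
    rw [BitProtocol.stateAfter]
    simp only [blockProtocol] at hc ⊢
    rw [if_neg (by omega)]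

theorem blockProtocol_msg_iff {σ : BlockState k n R T} (hσ : (σ.1 : ℕ) ≠ 0) (u w : Fin n) :
    (blockProtocol k n s p R T target).msg u σ w = true ↔
      ∃ j : Slot k R, (slotIndex k R j : ℕ) = (σ.1 - 1) % (k * k * R) ∧
        BlockBit s (fun x => σ.2.1 x = true) u
          (batchTuple k p ((σ.1 - 1) / (k * k * R)) w j.1.1)
          (batchTuple k p ((σ.1 - 1) / (k * k * R)) w j.1.2) j.2 := by
  simp only [blockProtocol, if_neg hσ, decide_eq_true_iff]

theorem blockProtocol_next_buffer (w : Fin n) (σ : BlockState k n R T) (m : Fin n → Bool)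
    (j : Slot k R) :
    ((blockProtocol k n s p R T target).next w σ m).2.2 j =
      if (slotIndex k R j : ℕ) = (σ.1 - 1) % (k * k * R) then m else σ.2.2 j :=
  rfl

/-- In round `i + 1` of batch `b`, the slot with index `i` is filled with the block bits of the
tuple of batch `b`, and no other slot changes. -/
theorem blockProtocol_buffer_succ (G : SimpleGraph (Fin n)) (b i : ℕ) (hi : i < k * k * R)
    (hT : 1 + b * (k * k * R) + i < T) (w u : Fin n) (j : Slot k R) :
    ((blockProtocol k n s p R T target).stateAfter G (1 + b * (k * k * R) + i + 1) w).2.2 j u = true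
      ↔ if (slotIndex k R j : ℕ) = i then
          BlockBit s (Share s G u) u (batchTuple k p b w j.1.1) (batchTuple k p b w j.1.2) j.2
        else ((blockProtocol k n s p R T target).stateAfter G
          (1 + b * (k * k * R) + i) w).2.2 j u = true := by
  have hc : ∀ v, _ := blockProtocol_counter (k := k) (s := s) (p := p) (R := R)
    (T := T) (target := target) G (1 + b * (k * k * R) + i) hT.le
  have hshare : (fun x => ((blockProtocol k n s p R T target).stateAfter G
      (1 + b * (k * k * R) + i) u).2.1 x = true) = Share s G u := by
    funext x
    have := blockProtocol_shares (k := k) (s := s) (p := p) (R := R) (T := T)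
      (target := target) G (b * (k * k * R) + i) (by omega) u x
    rw [show b * (k * k * R) + i + 1 = 1 + b * (k * k * R) + i by ring] at this
    exact propext this
  have hsub : 1 + b * (k * k * R) + i - 1 = i + b * (k * k * R) := by omega
  have hmod : (i + b * (k * k * R)) % (k * k * R) = i := by
    rw [Nat.add_mul_mod_self_right, Nat.mod_eq_of_lt hi]
  have hdiv : (i + b * (k * k * R)) / (k * k * R) = b := by
    rw [Nat.add_mul_div_right _ _ (by omega), Nat.div_eq_of_lt hi, zero_add]
  rw [BitProtocol.stateAfter]
  generalize (blockProtocol k n s p R T target).stateAfter G (1 + b * (k * k * R) + i) = σ at *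
  rw [blockProtocol_next_buffer, hc, hsub, hmod]
  split_ifs with hj
  · rw [blockProtocol_msg_iff (by rw [hc]; omega), hc, hsub, hmod, hdiv, hshare]
    constructor
    · rintro ⟨j', hj', hbit⟩
      have : j' = j := (slotIndex k R).injective (Fin.ext (hj'.trans hj.symm))
      rwa [this] at hbit
    · exact fun h => ⟨j, hj, h⟩
  · rfl

/-- At the end of batch `b`, the buffer of every node holds the blocks of its tuple of parts. -/
theorem blockProtocol_buffer (G : SimpleGraph (Fin n)) (b : ℕ)
    (hT : 1 + (b + 1) * (k * k * R) ≤ T) (w u : Fin n) (j : Slot k R) :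
    ((blockProtocol k n s p R T target).stateAfter G (1 + (b + 1) * (k * k * R)) w).2.2 j u = true
      ↔ BlockBit s (Share s G u) u (batchTuple k p b w j.1.1) (batchTuple k p b w j.1.2) j.2 := by
  have hexp : 1 + (b + 1) * (k * k * R) = 1 + b * (k * k * R) + k * k * R := by ring
  have key : ∀ i ≤ k * k * R, (slotIndex k R j : ℕ) < i →
      (((blockProtocol k n s p R T target).stateAfter G
        (1 + b * (k * k * R) + i) w).2.2 j u = true ↔ BlockBit s (Share s G u) u
          (batchTuple k p b w j.1.1) (batchTuple k p b w j.1.2) j.2) := by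
    intro i
    induction i with
    | zero => intro _ h; omega
    | succ i ih =>
      intro hi hj
      rw [← add_assoc, blockProtocol_buffer_succ G b i (by omega) (by omega)]
      split_ifs with h
      · rfl
      · exact ih (by omega) (by omega)
  rw [hexp]
  exact key _ le_rfl (slotIndex k R j).2

/-- The protocol lists exactly the members of `target`, provided these have `k` vertices and depend
only on the adjacencies between these vertices. The hypotheses on the parameters say that there are
enough parts, slots and rounds. -/
theorem mem_listed_blockProtocol_iff (hs : 0 < s) (hp : ∀ x < n, x / s < p)
    (hR : ∀ z < s * s, z / n < R) (hT : ∀ m < p ^ k, 1 + (m / n + 1) * (k * k * R) ≤ T)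
    (hn : 0 < n) (hcard : ∀ G, ∀ H ∈ target G, H.verts.ncard = k)
    (hlocal : ∀ G G' H, (∀ x ∈ H.verts, ∀ y ∈ H.verts, (G.Adj x y ↔ G'.Adj x y)) →
      H ∈ target G → H ∈ target G')
    (G : SimpleGraph (Fin n)) (H : Piece n) :
    H ∈ (blockProtocol k n s p R T target).listed G T ↔ H ∈ target G := by
  have hz : ∀ x y : Fin n, (s * ((x : ℕ) % s) + y % s) / n < R := by
    intro x y
    apply hR
    have hx := Nat.mod_lt (x : ℕ) hs
    have hy := Nat.mod_lt (y : ℕ) hs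
    calc s * ((x : ℕ) % s) + y % s < s * ((x : ℕ) % s) + s := by omega
      _ = s * (x % s + 1) := by ring
      _ ≤ s * s := Nat.mul_le_mul_left s hx
  -- A full buffer gives the adjacencies of the input graph within the tuple of parts.
  have hknown : ∀ b, 1 + (b + 1) * (k * k * R) ≤ T → ∀ (w x y : Fin n) (j : Slot k R),
      (x : ℕ) / s = batchTuple k p b w j.1.1 → (y : ℕ) / s = batchTuple k p b w j.1.2 →
      (s * (x % s) + y % s) / n = j.2 →
      (((blockProtocol k n s p R T target).stateAfter G (1 + (b + 1) * (k * k * R)) w).2.2 j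
        (holder s x y) = true ↔ G.Adj x y) := by
    intro b hb w x y j hx hy hr
    rw [blockProtocol_buffer G b hb, ← hx, ← hy, ← hr]
    exact blockBit_share_iff hs G x y
  constructor
  · rintro ⟨t, ht, w, b, hcnt, hparts, G', hG', hadj⟩
    rw [blockProtocol_counter G t ht] at hcnt
    subst hcnt
    refine hlocal G' G H (fun x hx y hy => ?_) hG'
    obtain ⟨a, ha⟩ := hparts x hx
    obtain ⟨a', ha'⟩ := hparts y hy
    let j : Slot k R := ((a, a'), ⟨_, hz x y⟩)
    exact (hadj x hx y hy j ha ha' rfl).symm.trans (hknown b ht w x y j ha ha' rfl)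
  · intro hH
    have hk := hcard G H hH
    let e : Fin k ≃ H.verts := (Finite.equivFinOfCardEq hk).symm
    obtain ⟨m, hm, htup⟩ := exists_partTuple_eq (p := p) (fun a : Fin k => (e a : Fin n).1 / s)
      (fun a => hp _ (e a : Fin n).2)
    have hb := hT m hm
    let w : Fin n := ⟨m % n, Nat.mod_lt _ hn⟩
    have hbatch : batchTuple k p (m / n) w = fun a : Fin k => (e a : Fin n).1 / s := by
      rw [← htup, batchTuple, Nat.div_add_mod']
    refine ⟨_, hb, w, m / n, blockProtocol_counter G _ hb w, fun x hx => ?_, G, hH,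
      fun x _ y _ j => hknown _ hb w x y j⟩
    refine ⟨e.symm ⟨x, hx⟩, ?_⟩
    rw [hbatch]
    simp

end Correctness

/-! ### Memory and running time -/

/-- The number of rounds: one for spreading the matrix, and a batch for every `n` tuples. -/
def rounds (k n μ : ℕ) : ℕ :=
  1 + ((n / Nat.sqrt μ + 1) ^ k / n + 1) * (k * k * (μ / n + 1))

/-- A round counter fits into `O(μ)` bits. No finer bound is needed, as the buffer may
have `O(μ)` bits anyway. -/
theorem rounds_lt_two_pow {k n μ : ℕ} (hμ : n ≤ μ) (hn : 1 ≤ n) :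
    rounds k n μ + 1 ≤ 2 ^ ((3 * k + 4) * μ) := by
  have hμ1 : 1 ≤ μ := hn.trans hμ
  have hpow : ∀ a : ℕ, a + 1 ≤ 2 ^ a := fun a => Nat.lt_two_pow_self
  have h1 : (n / Nat.sqrt μ + 1) ^ k / n + 1 ≤ 2 ^ (k * μ + 1) := by
    have : (n / Nat.sqrt μ + 1) ^ k ≤ 2 ^ (k * μ) := by
      calc (n / Nat.sqrt μ + 1) ^ k ≤ (2 ^ μ) ^ k := by
            gcongr
            exact (Nat.succ_le_succ ((Nat.div_le_self _ _).trans hμ)).trans (hpow μ)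
        _ = 2 ^ (k * μ) := by rw [← pow_mul, mul_comm]
    have h2 := Nat.div_le_self ((n / Nat.sqrt μ + 1) ^ k) n
    have h3 : 1 ≤ 2 ^ (k * μ) := Nat.one_le_two_pow
    rw [pow_succ]
    omega
  have h2 : k * k * (μ / n + 1) ≤ 2 ^ (2 * k + μ) := by
    have hk : k ≤ 2 ^ k := (Nat.le_succ k).trans (hpow k)
    calc k * k * (μ / n + 1) ≤ 2 ^ k * 2 ^ k * 2 ^ μ := by
          gcongr
          exact (Nat.succ_le_succ (Nat.div_le_self _ _)).trans (hpow μ)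
      _ = 2 ^ (2 * k + μ) := by ring
  calc rounds k n μ + 1 ≤ 2 + 2 ^ (k * μ + 1) * 2 ^ (2 * k + μ) := by
        have := Nat.mul_le_mul h1 h2
        unfold rounds
        omega
    _ ≤ 2 ^ (k * μ + 1 + (2 * k + μ) + 2) := by
        rw [← pow_add, pow_add 2 (k * μ + 1 + (2 * k + μ)) 2]
        have : 1 ≤ 2 ^ (k * μ + 1 + (2 * k + μ)) := Nat.one_le_two_pow
        omega
    _ ≤ 2 ^ ((3 * k + 4) * μ) := by
        gcongr
        · norm_num
        · nlinarith [Nat.mul_le_mul_left k hμ1]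

theorem card_blockState_le {k n μ : ℕ} (hμ : n ≤ μ) (hn : 1 ≤ n) :
    Fintype.card (BlockState k n (μ / n + 1) (rounds k n μ)) ≤
      Fintype.card (Memory (2 * k * k + 3 * k + 5) n μ) := by
  have hbuf : n * (k * k * (μ / n + 1)) ≤ 2 * k * k * μ := by
    have := Nat.mul_div_le μ n
    calc n * (k * k * (μ / n + 1)) = k * k * (n * (μ / n) + n) := by ring
      _ ≤ k * k * (μ + μ) := by gcongr
      _ = 2 * k * k * μ := by ring
  calc Fintype.card (BlockState k n (μ / n + 1) (rounds k n μ))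
      = (rounds k n μ + 1) * (2 ^ n * 2 ^ (n * (k * k * (μ / n + 1)))) := by
        simp [pow_mul]
    _ ≤ 2 ^ ((3 * k + 4) * μ) * (2 ^ μ * 2 ^ (2 * k * k * μ)) := by
        gcongr
        · exact rounds_lt_two_pow hμ hn
        · norm_num
        · norm_num
    _ = 2 ^ ((2 * k * k + 3 * k + 5) * μ) := by ring
    _ ≤ 2 ^ ((2 * k * k + 3 * k + 5) * (Nat.log 2 n + 1) * μ) := by
        gcongr
        · norm_num
        · exact Nat.le_mul_of_pos_right _ (Nat.succ_pos _)
    _ = Fintype.card (Memory (2 * k * k + 3 * k + 5) n μ) := by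
        simp [pow_mul]

/-- Every family of `k`-node pieces that depends only on the adjacencies between their vertices
can be listed in `rounds k n μ` rounds. -/
theorem listableIn_rounds {k n μ : ℕ} (hμ : n ≤ μ) (hn : 1 ≤ n)
    {target : SimpleGraph (Fin n) → Set (Piece n)}
    (hcard : ∀ G, ∀ H ∈ target G, H.verts.ncard = k)
    (hlocal : ∀ G G' H, (∀ x ∈ H.verts, ∀ y ∈ H.verts, (G.Adj x y ↔ G'.Adj x y)) →
      H ∈ target G → H ∈ target G') :
    ListableIn (2 * k * k + 3 * k + 5) n μ (rounds k n μ) target := by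
  obtain ⟨enc⟩ := Function.Embedding.nonempty_of_card_le (card_blockState_le (k := k) hμ hn)
  obtain ⟨A, hA⟩ := BitProtocol.exists_algorithm_listed_eq (by positivity) enc
    (blockProtocol k n (Nat.sqrt μ) (n / Nat.sqrt μ + 1) (μ / n + 1) (rounds k n μ) target)
  refine ⟨A, fun G => ?_⟩
  rw [hA]
  ext H
  refine mem_listed_blockProtocol_iff (Nat.sqrt_pos.2 (by omega)) ?_ ?_ ?_ hn hcard hlocal G H
  · exact fun x hx => Nat.lt_succ_of_le (Nat.div_le_div_right hx.le)
  · exact fun z hz => Nat.lt_succ_of_le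
      (Nat.div_le_div_right (hz.le.trans (Nat.sqrt_le μ)))
  · intro m hm
    unfold rounds
    gcongr

/-- The number of rounds is `O((n / √μ) ^ (k - 2))`. The upper bound on `μ` enters as
`n ≤ (n / √μ) ^ k`: there are at least as many tuples of parts as nodes. -/
theorem rounds_le {k n μ : ℕ} (hk : 1 ≤ k) (hn : 1 ≤ n) (hμ : n ≤ μ)
    (hμ' : (μ : ℝ) ≤ (n : ℝ) ^ (2 - 2 / (k : ℝ))) :
    (rounds k n μ : ℝ) ≤ (4 * k ^ 2 * (3 ^ k + 1)) *
      ((n : ℝ) ^ ((k : ℝ) - 2) / (μ : ℝ) ^ ((k : ℝ) / 2 - 1)) := by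
  have hk0 : (0 : ℝ) < k := by exact_mod_cast hk
  have hn1 : (1 : ℝ) ≤ n := by exact_mod_cast hn
  have hn0 : (0 : ℝ) < n := by linarith
  have hμn : (n : ℝ) ≤ μ := by exact_mod_cast hμ
  have hμ0 : (0 : ℝ) < μ := by linarith
  set q : ℝ := √(μ : ℝ) with hq
  have hq0 : 0 < q := Real.sqrt_pos.2 hμ0
  have hqq : q ^ 2 = μ := Real.sq_sqrt hμ0.le
  have hq1 : 1 ≤ q := Real.one_le_sqrt.2 (hn1.trans hμn)
  have hμk : (μ : ℝ) ^ ((k : ℝ) / 2) = q ^ k := by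
    rw [hq, Real.sqrt_eq_rpow, ← Real.rpow_natCast, ← Real.rpow_mul hμ0.le]
    congr 1
    ring
  have htarget : (n : ℝ) ^ ((k : ℝ) - 2) / (μ : ℝ) ^ ((k : ℝ) / 2 - 1) =
      (n / q) ^ k / n * (μ / n) := by
    rw [Real.rpow_sub hn0, Real.rpow_sub hμ0, hμk, Real.rpow_one, Real.rpow_natCast,
      show (2 : ℝ) = ((2 : ℕ) : ℝ) by norm_num, Real.rpow_natCast, div_pow]
    field_simp
  have hqk : q ^ k * n ≤ (n : ℝ) ^ k := by
    rw [← hμk]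
    calc (μ : ℝ) ^ ((k : ℝ) / 2) * n
        ≤ ((n : ℝ) ^ (2 - 2 / (k : ℝ))) ^ ((k : ℝ) / 2) * n := by gcongr
      _ = (n : ℝ) ^ ((k : ℝ) - 1) * n := by
          rw [← Real.rpow_mul hn0.le]
          congr 2
          field_simp
      _ = (n : ℝ) ^ k := by
          rw [Real.rpow_sub hn0, Real.rpow_natCast, Real.rpow_one]
          field_simp
  have htuples : 1 ≤ (n / q) ^ k / n := by
    rw [div_pow, div_div, one_le_div (by positivity)]
    exact hqk
  have hqn : q ≤ n := by
    by_contra! h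
    have h1 : (n : ℝ) ^ k < q ^ k := pow_lt_pow_left₀ h hn0.le (by omega)
    nlinarith [pow_pos hq0 k]
  have hs0 : 0 < Nat.sqrt μ := Nat.sqrt_pos.2 (by omega)
  have hs1 : (1 : ℝ) ≤ Nat.sqrt μ := by exact_mod_cast hs0
  -- Rounding `√μ` down costs at most a factor of two.
  have hqs : q ≤ 2 * Nat.sqrt μ := by
    have h := Real.real_sqrt_le_nat_sqrt_succ (a := μ)
    rw [← hq] at h
    linarith
  have hparts : ((n / Nat.sqrt μ + 1 : ℕ) : ℝ) ≤ 3 * (n / q) := by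
    have h1 : ((n / Nat.sqrt μ : ℕ) : ℝ) ≤ n / Nat.sqrt μ := Nat.cast_div_le
    have h2 : (n : ℝ) / Nat.sqrt μ ≤ 2 * (n / q) := by
      rw [← mul_div_assoc, div_le_div_iff₀ (by positivity) hq0]
      nlinarith
    have h3 : 1 ≤ n / q := (one_le_div hq0).2 hqn
    push_cast
    linarith
  have hbatches : (((n / Nat.sqrt μ + 1) ^ k / n + 1 : ℕ) : ℝ) ≤
      (3 ^ k + 1) * ((n / q) ^ k / n) := by
    have h1 : (((n / Nat.sqrt μ + 1) ^ k / n : ℕ) : ℝ) ≤ (3 * (n / q)) ^ k / n := by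
      refine Nat.cast_div_le.trans ?_
      rw [Nat.cast_pow]
      gcongr
    rw [mul_pow, mul_div_assoc] at h1
    push_cast at h1 ⊢
    linarith
  have hquot : ((μ / n + 1 : ℕ) : ℝ) ≤ 2 * (μ / n) := by
    have h1 : ((μ / n : ℕ) : ℝ) ≤ μ / n := Nat.cast_div_le
    have h2 : (1 : ℝ) ≤ μ / n := (one_le_div hn0).2 hμn
    push_cast
    linarith
  -- The first round is absorbed, as the batches take at least one round.
  have hone : 1 ≤ ((n / Nat.sqrt μ + 1) ^ k / n + 1) * (k * k * (μ / n + 1)) :=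
    Nat.succ_le_of_lt (by positivity)
  have hdouble : rounds k n μ ≤
      2 * (((n / Nat.sqrt μ + 1) ^ k / n + 1) * (k * k * (μ / n + 1))) := by
    unfold rounds
    omega
  rw [htarget]
  calc (rounds k n μ : ℝ)
      ≤ 2 * ((((n / Nat.sqrt μ + 1) ^ k / n + 1 : ℕ) : ℝ) *
          (k * k * ((μ / n + 1 : ℕ) : ℝ))) := by exact_mod_cast hdouble
    _ ≤ 2 * (((3 ^ k + 1) * ((n / q) ^ k / n)) * (k * k * (2 * (μ / n)))) := by gcongr
    _ = (4 * k ^ 2 * (3 ^ k + 1)) * ((n / q) ^ k / n * (μ / n)) := by ring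

end MuCongestedClique

theorem theorem9 (k : ℕ) (hk : 1 ≤ k) :
    ∃ (c : ℕ) (C : ℝ), ∀ n μ : ℕ, 1 ≤ n → n ≤ μ → (μ : ℝ) ≤ (n : ℝ) ^ (2 - 2 / (k : ℝ)) →
      ∃ T : ℕ, (T : ℝ) ≤ C * ((n : ℝ) ^ ((k : ℝ) - 2) / (μ : ℝ) ^ ((k : ℝ) / 2 - 1)) ∧
        MuCongestedClique.ListableIn c n μ T (MuCongestedClique.kSubgraphs k) ∧
        MuCongestedClique.ListableIn c n μ T (MuCongestedClique.kInducedSubgraphs k) := by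
  refine ⟨2 * k * k + 3 * k + 5, 4 * k ^ 2 * (3 ^ k + 1), fun n μ hn hμ hμ' =>
    ⟨MuCongestedClique.rounds k n μ, MuCongestedClique.rounds_le hk hn hμ hμ',
      MuCongestedClique.listableIn_rounds hμ hn (fun _ _ hH => hH.1) ?_,
      MuCongestedClique.listableIn_rounds hμ hn (fun _ _ hH => hH.1) ?_⟩⟩
  · rintro G G' H hadj ⟨hcard, hsub⟩
    exact ⟨hcard, fun a b hab =>
      (hadj a (H.edge_vert hab) b (H.edge_vert hab.symm)).1 (hsub a b hab)⟩
  · rintro G G' H hadj ⟨hcard, hind⟩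
    refine ⟨hcard, fun a b => (hind a b).trans ?_⟩
    constructor
    · exact fun ⟨ha, hb, h⟩ => ⟨ha, hb, (hadj a ha b hb).1 h⟩
    · exact fun ⟨ha, hb, h⟩ => ⟨ha, hb, (hadj a ha b hb).2 h⟩
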